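/- Let $W$ be a finite-dimensional real symplectic space with symplectic form $\langle\,,\,\rangle_W$. An involution on an $\mathbb R$-algebra is an $\mathbb R$-linear anti-automorphism whose square is the identity. Let $\tau$ be the adjoint involution of $\langle\,,\,\rangle_W$, i.e. the involution on $\mathrm{End}_{\mathbb R}(W)$ determined by $\langle x u,v\rangle_W=\langle u,\tau(x)v\rangle_W$ for all $u,v\in W$, $x\in \mathrm{End}_{\mathbb R}(W)$. Let $(A,A')$ be a pair of $\tau$-stable semisimple real subalgebras of $\mathrm{End}_{\mathbb R}(W)$ which are mutual centralizers of each other in $\mathrm{End}_{\mathbb R}(W)$, and put $G:=A\cap \mathrm{Sp}(W)$, $G':=A'\cap \mathrm{Sp}(W)$ (so that $(G,G')$ is a reductive dual pair in $\mathrm{Sp}(W)$). An involution $\sigma$ on $\mathrm{End}_{\mathbb R}(W)$ is called a Cartan involution if there is a positive-definite symmetric bilinear form $\langle\,,\,\rangle_\sigma$ on $W$ such that $\langle x u,v\rangle_\sigma=\langle u,\sigma(x)v\rangle_\sigma$ for all $u,v\in W$, $x\in\mathrm{End}_{\mathbb R}(W)$. For an invertible $a\in \mathrm{End}_{\mathbb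 R}(W)$, the conjugate of an involution $\sigma$ by $a$ is the involution $a\sigma a^{-1}:=\mathrm{Int}(a)\circ\sigma\circ\mathrm{Int}(a^{-1})$, where $\mathrm{Int}(a)(x)=axa^{-1}$. Then, up to conjugation by $G\times G'$, there exists a unique Cartan involution $\sigma$ on $\mathrm{End}_{\mathbb R}(W)$ such that $$\sigma\circ\tau=\tau\circ\sigma,\qquad \sigma(A)=A,\qquad \sigma(A')=A'.$$ That is, such a $\sigma$ exists, and if $\sigma$ is one, then the involutions with these properties are exactly the conjugates $(gg')\sigma(gg')^{-1}$ with $g\in G$ and $g'\in G'$. -/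

import Mathlib

/-- An involution on a (real) algebra: a linear anti-automorphism whose square is the identity. -/
@[ext]
structure AlgInvolution (R : Type*) [CommRing R] (E : Type*) [Ring E] [Algebra R E]
    extends E →ₗ[R] E where
  map_mul_rev' : ∀ x y : E, toFun (x * y) = toFun y * toFun x
  map_map' : ∀ x : E, toFun (toFun x) = x

namespace AlgInvolution

instance instFunLike (R : Type*) [CommRing R] (E : Type*) [Ring E] [Algebra R E] :
    FunLike (AlgInvolution R E) E E where
  coe σ := σ.toLinearMap
  coe_injective σ σ' h := by
    cases σ
    cases σ'
    congr 1
    exact DFunLike.coe_injective h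

/-- The conjugate `a γ a⁻¹ = Int(a) ∘ γ ∘ Int(a⁻¹)` of an involution `γ` by a unit `a`,
where `Int(a) x = a x a⁻¹`. -/
def conj {R : Type*} [CommRing R] {E : Type*} [Ring E] [Algebra R E]
    (a : Eˣ) (γ : AlgInvolution R E) : AlgInvolution R E where
  toFun x := a * γ.toFun (a⁻¹.val * x * a) * a⁻¹.val
  map_add' x y := by
    have h := γ.map_add'
    simp only [mul_add, add_mul, h]
  map_smul' r x := by
    have h := γ.map_smul'
    simp only [mul_smul_comm, smul_mul_assoc, h, RingHom.id_apply]
  map_mul_rev' x y := by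
    have h : a⁻¹.val * (x * y) * a = (a⁻¹.val * x * a) * (a⁻¹.val * y * a) := by
      simp [mul_assoc]
    have h2 := γ.map_mul_rev' (a⁻¹.val * x * a) (a⁻¹.val * y * a)
    rw [h, h2]
    simp [mul_assoc]
  map_map' x := by
    have h2 := γ.map_map' (a⁻¹.val * x * a)
    simp only [← mul_assoc, Units.inv_mul, one_mul]
    simp only [mul_assoc, Units.inv_mul, mul_one]
    simp only [← mul_assoc]
    rw [h2]
    simp [← mul_assoc]

theorem conj_apply {R : Type*} [CommRing R] {E : Type*} [Ring E] [Algebra R E]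
    (a : Eˣ) (γ : AlgInvolution R E) (x : E) :
    conj a γ x = a * γ (a⁻¹.val * x * a) * a⁻¹.val := rfl

/-- A subalgebra is stable under an involution `σ` if `σ(A) = A`. -/
def Stabilizes {R : Type*} [CommRing R] {E : Type*} [Ring E] [Algebra R E]
    (σ : AlgInvolution R E) (A : Subalgebra R E) : Prop :=
  σ '' (A : Set E) = (A : Set E)

end AlgInvolution

section Symplectic

variable {W : Type*} [AddCommGroup W] [Module ℝ W] [FiniteDimensional ℝ W]

/-- Uniqueness of adjoints with respect to a nondegenerate form. -/
theorem eq_leftAdjoint (ω : LinearMap.BilinForm ℝ W) (hnd : ω.Nondegenerate)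
    {x y : Module.End ℝ W} (h : ∀ u v : W, ω (y u) v = ω u (x v)) :
    y = ω.leftAdjointOfNondegenerate hnd x :=
  (ω.isAdjointPair_iff_eq_of_nondegenerate hnd y x).1 h

/-- The defining property of the left adjoint. -/
theorem leftAdjoint_spec (ω : LinearMap.BilinForm ℝ W) (hnd : ω.Nondegenerate)
    (x : Module.End ℝ W) (u v : W) : ω (ω.leftAdjointOfNondegenerate hnd x u) v = ω u (x v) :=
  ω.isAdjointPairLeftAdjointOfNondegenerate hnd x u v

/-- For an alternating form the left adjoint is also a right adjoint. -/
theorem leftAdjoint_spec' (ω : LinearMap.BilinForm ℝ W) (halt : ω.IsAlt) (hnd : ω.Nondegenerate)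
    (x : Module.End ℝ W) (u v : W) : ω (x u) v = ω u (ω.leftAdjointOfNondegenerate hnd x v) := by
  rw [← halt.neg_eq, ← leftAdjoint_spec ω hnd x v u, halt.neg_eq]

/-- The adjoint involution `τ` of a symplectic form `ω` on `W`, an involution on `End_ℝ(W)`;
it is characterized by `ω (x u) v = ω u (τ x v)`, see `symplecticAdjoint_spec`. -/
noncomputable def symplecticAdjoint (ω : LinearMap.BilinForm ℝ W) (halt : ω.IsAlt)
    (hnd : ω.Nondegenerate) : AlgInvolution ℝ (Module.End ℝ W) where
  toFun x := ω.leftAdjointOfNondegenerate hnd x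
  map_add' x y := by
    refine (eq_leftAdjoint ω hnd fun u v => ?_).symm
    simp only [LinearMap.add_apply, map_add, leftAdjoint_spec]
  map_smul' r x := by
    refine (eq_leftAdjoint ω hnd fun u v => ?_).symm
    simp only [LinearMap.smul_apply, map_smul, leftAdjoint_spec, RingHom.id_apply]
  map_mul_rev' x y := by
    refine (eq_leftAdjoint ω hnd fun u v => ?_).symm
    simp only [Module.End.mul_apply, leftAdjoint_spec]
  map_map' x :=
    (eq_leftAdjoint ω hnd (leftAdjoint_spec' ω halt hnd x)).symm

/-- The defining property of the adjoint involution. -/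
theorem symplecticAdjoint_spec (ω : LinearMap.BilinForm ℝ W) (halt : ω.IsAlt)
    (hnd : ω.Nondegenerate) (x : Module.End ℝ W) (u v : W) :
    ω (x u) v = ω u (symplecticAdjoint ω halt hnd x v) :=
  leftAdjoint_spec' ω halt hnd x u v

/-- The symplectic group `Sp(W)`, as a subgroup of the group of units of `End_ℝ(W)`. -/
def symplecticSubgroup (ω : LinearMap.BilinForm ℝ W) : Subgroup (Module.End ℝ W)ˣ where
  carrier := {g | ∀ u v : W, ω (g.val u) (g.val v) = ω u v}
  one_mem' u v := by simp
  mul_mem' {g h} hg hh u v := by simp [hg _ _, hh _ _]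
  inv_mem' {g} hg u v := by
    have key : ∀ w : W, g.val (g⁻¹.val w) = w := fun w => by
      rw [← Module.End.mul_apply, Units.mul_inv, Module.End.one_apply]
    rw [← hg, key, key]

/-- The group `A ∩ Sp(W)` attached to a subalgebra `A` of `End_ℝ(W)`. -/
def symplecticPart (ω : LinearMap.BilinForm ℝ W) (A : Subalgebra ℝ (Module.End ℝ W)) :
    Subgroup (Module.End ℝ W)ˣ where
  carrier := {g | g.val ∈ A ∧ g ∈ symplecticSubgroup ω}
  one_mem' := ⟨A.one_mem, (symplecticSubgroup ω).one_mem⟩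
  mul_mem' hg hh := ⟨A.mul_mem hg.1 hh.1, (symplecticSubgroup ω).mul_mem hg.2 hh.2⟩
  inv_mem' {g} hg := by
    refine ⟨?_, (symplecticSubgroup ω).inv_mem hg.2⟩
    have hinj : Function.Injective (LinearMap.mulLeft ℝ (⟨g.val, hg.1⟩ : A)) := by
      intro x y hxy
      have h : g.val * x.val = g.val * y.val := congrArg Subtype.val hxy
      exact Subtype.ext (g.mul_right_inj.1 h)
    obtain ⟨x, hx⟩ := LinearMap.injective_iff_surjective.1 hinj 1
    have h : g.val * x.val = 1 := congrArg Subtype.val hx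
    have h' : g⁻¹.val = x.val := Units.inv_eq_of_mul_eq_one_right h
    rw [h']
    exact x.2

/-- `(A, A')` is a pair of semisimple subalgebras of `End_ℝ(W)` which are stable under the
adjoint involution of the symplectic form `ω` and are mutual centralizers of each other in
`End_ℝ(W)`; then `(A ∩ Sp(W), A' ∩ Sp(W))` is a reductive dual pair in `Sp(W)`. -/
structure IsDualPairOfAlgebras (ω : LinearMap.BilinForm ℝ W) (halt : ω.IsAlt)
    (hnd : ω.Nondegenerate) (A A' : Subalgebra ℝ (Module.End ℝ W)) : Prop where
  semisimple_left : IsSemisimpleRing A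
  semisimple_right : IsSemisimpleRing A'
  stable_left : (symplecticAdjoint ω halt hnd).Stabilizes A
  stable_right : (symplecticAdjoint ω halt hnd).Stabilizes A'
  centralizer_left : Subalgebra.centralizer ℝ (A : Set (Module.End ℝ W)) = A'
  centralizer_right : Subalgebra.centralizer ℝ (A' : Set (Module.End ℝ W)) = A

/-- An involution `σ` on `End_ℝ(W)` is a Cartan involution if it is the adjoint involution of a
positive-definite symmetric bilinear form on `W`. -/
def IsCartanInvolution (σ : AlgInvolution ℝ (Module.End ℝ W)) : Prop :=
  ∃ B : LinearMap.BilinForm ℝ W, B.IsSymm ∧ (∀ v : W, v ≠ 0 → 0 < B v v) ∧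
    ∀ (x : Module.End ℝ W) (u v : W), B (x u) v = B u (σ x v)

/-- `σ` is a Cartan involution on `End_ℝ(W)` which commutes with the adjoint involution of `ω` and
satisfies `σ(A) = A` and `σ(A') = A'`. -/
structure IsAdaptedCartanInvolution (ω : LinearMap.BilinForm ℝ W) (halt : ω.IsAlt)
    (hnd : ω.Nondegenerate) (A A' : Subalgebra ℝ (Module.End ℝ W))
    (σ : AlgInvolution ℝ (Module.End ℝ W)) : Prop where
  cartan : IsCartanInvolution σ
  comm : ⇑σ ∘ ⇑(symplecticAdjoint ω halt hnd) = ⇑(symplecticAdjoint ω halt hnd) ∘ ⇑σ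
  stable_left : σ.Stabilizes A
  stable_right : σ.Stabilizes A'

end Symplectic

/-! For an inner product `B` with adjoint involution `σ`, write `ω u v = B (J u) v`; then `σ J = -J`
and `τ` is `σ` conjugated by `J`. If `σ` and `τ` commute, `J * J` is a negative scalar, and
rescaling `B` makes it `-1`; conversely `J * J = -1` forces commutation. So an adapted involution
amounts to an inner product with `J * J = -1` for which `A` is self-adjoint; the centralizer `A'` is
then self-adjoint too.

Existence. The trace form of the semisimple algebra `A` yields a Casimir element, which makes the
conjugation orbit of the inclusion of `A` closed. At a point of least norm the moment map vanishes
(Kempf–Ness), so the commutant `A'`, and with it `A`, is self-adjoint for some `B`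
(`exists_form_commutant_selfAdjoint`). Replacing `B` by `B (R u) v` with `R` the positive square
root of `-(J * J)` turns `J` into `R⁻¹J`, of square `-1`. That `R` normalizes `A` follows from its
logarithm: `P = -(J * J)` normalizes `A`, so `ad (log P)` preserves `A` (`exists_log`), and since
derivations of `A` are inner, `log P` lies in `A + A'` (`exists_sub_mem_centralizer`).

Conjugacy. Two normalized forms differ by a positive `P` with `P * J * P = J`, so `L = log P`
satisfies `τ L = -L`. Again `L` lies in `A + A'`, and the `τ`-skew parts of its components
exponentiate into `G` and `G'`. Their product can be taken to be `exp (-L/2)`, which carries one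
involution to the other. -/

/-! ### Separability of semisimple algebras through the regular trace form. -/

section Separability

variable {K A : Type*} [Field K] [Ring A] [Algebra K A]

/-- The trace of left multiplication on an algebra. -/
noncomputable def regularTrace (K A : Type*) [Field K] [Ring A] [Algebra K A] : A →ₗ[K] K :=
  (LinearMap.trace K A).comp (LinearMap.mul K A)

theorem regularTrace_apply (x : A) :
    regularTrace K A x = LinearMap.trace K A (LinearMap.mul K A x) := rfl

theorem regularTrace_mul_comm (x y : A) : regularTrace K A (x * y) = regularTrace K A (y * x) := by
  have h : ∀ x y : A, LinearMap.mul K A (x * y) = LinearMap.mul K A x * LinearMap.mul K A y :=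
    fun x y => LinearMap.ext fun z => mul_assoc x y z
  rw [regularTrace_apply, regularTrace_apply, h, h, LinearMap.trace_mul_comm]

/-- The regular trace form of a semisimple algebra in characteristic zero is nondegenerate. -/
theorem eq_zero_of_forall_regularTrace_mul_eq_zero [CharZero K] [FiniteDimensional K A]
    [IsSemisimpleRing A] {x : A} (hx : ∀ y, regularTrace K A (x * y) = 0) : x = 0 := by
  -- The left ideal of `x` is generated by an idempotent `e = z * x`. Left multiplication by `e` is
  -- an idempotent of trace zero, hence zero in characteristic zero.
  obtain ⟨e, he, hspan⟩ := IsSemisimpleRing.ideal_eq_span_idempotent (Ideal.span {x})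
  have hxe : e ∈ Ideal.span {x} := hspan ▸ Ideal.subset_span rfl
  obtain ⟨z, hz⟩ := Ideal.mem_span_singleton'.1 hxe
  have htr : LinearMap.trace K A (LinearMap.mul K A e) = 0 := by
    have h := hx z
    rw [regularTrace_mul_comm, hz] at h
    exact h
  have hidem : IsIdempotentElem (LinearMap.mul K A e) :=
    LinearMap.ext fun z => by
      rw [Module.End.mul_apply, LinearMap.mul_apply', LinearMap.mul_apply', ← mul_assoc, he.eq]
  have h0 := LinearMap.IsIdempotentElem.eq_zero_of_trace_eq_zero hidem htr
  have he0 : e = 0 := by simpa using LinearMap.congr_fun h0 1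
  rw [he0] at hspan
  have : x ∈ Ideal.span {(0 : A)} := hspan ▸ Ideal.subset_span rfl
  simpa using this

/-- The trace form of a not necessarily commutative algebra. -/
noncomputable def regularTraceForm (K A : Type*) [Field K] [Ring A] [Algebra K A] :
    LinearMap.BilinForm K A :=
  (LinearMap.mul K A).compr₂ (regularTrace K A)

theorem regularTraceForm_nondegenerate [CharZero K] [FiniteDimensional K A] [IsSemisimpleRing A] :
    (regularTraceForm K A).Nondegenerate :=
  ⟨fun _ hx => eq_zero_of_forall_regularTrace_mul_eq_zero (K := K) hx,
    fun _ hx => eq_zero_of_forall_regularTrace_mul_eq_zero (K := K) fun y =>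
      (regularTrace_mul_comm _ _).trans (hx y)⟩

open scoped TensorProduct in
/-- A semisimple algebra in characteristic zero is separable. -/
theorem exists_casimir [CharZero K] [FiniteDimensional K A] [IsSemisimpleRing A] {ι : Type*} [Fintype ι]
    (b : Module.Basis ι K A) :
    ∃ y : ι → A, ∑ i, b i * y i = 1 ∧
      ∀ a : A, ∑ i, (a * b i) ⊗ₜ[K] y i = ∑ i, b i ⊗ₜ[K] (y i * a) := by
  classical
  have hT := regularTraceForm_nondegenerate (K := K) (A := A)
  set T := regularTraceForm K A
  set c := T.dualBasis hT b
  have hb : ∀ a i, b.repr a i = T (c i) a := by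
    intro a i
    conv_rhs => rw [← b.sum_repr a]
    simp only [map_sum, map_smul, c, LinearMap.BilinForm.apply_dualBasis_left]
    simp
  have hc : ∀ a i, c.repr a i = T a (b i) := fun a i => by
    simp [c, LinearMap.BilinForm.dualBasis_repr_apply]
  refine ⟨c, ?_, fun a => ?_⟩
  -- Paired with `a`, the sum of the `b i * c i` gives the sum of the diagonal coefficients `T (c i)
  -- (a * b i)`, which is the trace of left multiplication by `a`.
  · rw [← sub_eq_zero]
    refine eq_zero_of_forall_regularTrace_mul_eq_zero (K := K) fun a => ?_
    rw [sub_mul, map_sub, sub_eq_zero, one_mul, Finset.sum_mul, map_sum, regularTrace_apply,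
      LinearMap.trace_eq_matrix_trace K b, Matrix.trace]
    refine Finset.sum_congr rfl fun i _ => ?_
    rw [Matrix.diag_apply, LinearMap.toMatrix_apply, hb]
    change _ = regularTrace K A (c i * (a * b i))
    rw [mul_assoc, regularTrace_mul_comm, mul_assoc]
  · have h1 : ∀ i, (a * b i) ⊗ₜ[K] c i = ∑ j, T (c j) (a * b i) • (b j ⊗ₜ[K] c i) := by
      intro i
      conv_lhs => rw [← b.sum_repr (a * b i)]
      simp only [TensorProduct.sum_tmul, hb, TensorProduct.smul_tmul']
    have h2 : ∀ j, b j ⊗ₜ[K] (c j * a) = ∑ i, T (c j) (a * b i) • (b j ⊗ₜ[K] c i) := by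
      intro j
      conv_lhs => rw [← c.sum_repr (c j * a)]
      simp only [TensorProduct.tmul_sum, hc, TensorProduct.tmul_smul]
      refine Finset.sum_congr rfl fun i _ => ?_
      congr 1
      change regularTrace K A (c j * a * b i) = regularTrace K A (c j * (a * b i))
      rw [mul_assoc]
    simp only [h1, h2]
    exact Finset.sum_comm

/-- Bilinear form of Casimir invariance; it produces both the intertwiner in the orbit argument and
the element making a derivation inner. -/
theorem sum_bilin_casimir {V ι : Type*} [AddCommGroup V] [Module K V] [Fintype ι] {b y : ι → A}
    {a : A} (h : ∑ i, TensorProduct.tmul K (a * b i) (y i) = ∑ i, TensorProduct.tmul K (b i) (y i * a))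
    (β : A →ₗ[K] A →ₗ[K] V) : ∑ i, β (a * b i) (y i) = ∑ i, β (b i) (y i * a) := by
  have := congrArg (TensorProduct.lift β) h
  simpa using this

end Separability

section MatrixMethods

open Matrix

/-! ### The moment map of the conjugation action. -/

section MomentMap

variable {n ι : Type*} [Fintype n] [Fintype ι]

theorem Matrix.eq_zero_of_trace_mul_transpose_self {x : Matrix n n ℝ} (h : (x * xᵀ).trace = 0) :
    x = 0 := by
  rw [← conjTranspose_eq_transpose_of_trivial] at h
  exact trace_mul_conjTranspose_self_eq_zero_iff.1 h

theorem Matrix.trace_mul_transpose_self_nonneg (x : Matrix n n ℝ) : 0 ≤ (x * xᵀ).trace := by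
  rw [trace]
  exact Finset.sum_nonneg fun i _ => by
    simp only [diag_apply, mul_apply, transpose_apply]
    exact Finset.sum_nonneg fun j _ => mul_self_nonneg _

theorem Matrix.trace_transpose_mul_eq_sum (x y : Matrix n n ℝ) :
    (xᵀ * y).trace = ∑ j, ∑ k, x j k * y j k := by
  simp only [trace, diag_apply, mul_apply, transpose_apply]
  exact Finset.sum_comm

/-- If the moment map vanishes at a tuple of matrices, then its commutant is stable under
transposition. -/
theorem commute_transpose_of_sum_commutator_eq_zero {a : ι → Matrix n n ℝ}
    (ha : ∑ i, (a i * (a i)ᵀ - (a i)ᵀ * a i) = 0) {x : Matrix n n ℝ} (hx : ∀ i, x * a i = a i * x)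
    (i : ι) : xᵀ * a i = a i * xᵀ := by
  have hxT : ∀ i, (a i)ᵀ * xᵀ = xᵀ * (a i)ᵀ := fun i => by
    rw [← transpose_mul, hx, transpose_mul]
  -- The squared norm of `[xᵀ, a i]` equals the trace of `[x, xᵀ] [a i, (a i)ᵀ]`, because `x`
  -- commutes with `a i`. Summed over `i`, the second factor is the moment map.
  have key : ∀ i, ((xᵀ * a i - a i * xᵀ) * (xᵀ * a i - a i * xᵀ)ᵀ).trace
      = ((x * xᵀ - xᵀ * x) * (a i * (a i)ᵀ - (a i)ᵀ * a i)).trace := by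
    intro i
    have e : (xᵀ * a i - a i * xᵀ)ᵀ = (a i)ᵀ * x - x * (a i)ᵀ := by
      simp [transpose_sub, transpose_mul]
    rw [e]
    have h1 : (xᵀ * a i * ((a i)ᵀ * x)).trace = (x * xᵀ * (a i * (a i)ᵀ)).trace := by
      rw [← mul_assoc, trace_mul_comm]; simp only [mul_assoc]
    have h2 : (xᵀ * a i * (x * (a i)ᵀ)).trace = (xᵀ * x * (a i * (a i)ᵀ)).trace := by
      rw [mul_assoc, ← mul_assoc (a i) x, ← hx]; simp only [mul_assoc]
    have h3 : (a i * xᵀ * ((a i)ᵀ * x)).trace = (xᵀ * x * (a i * (a i)ᵀ)).trace := by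
      rw [mul_assoc, ← mul_assoc xᵀ, ← hxT, mul_assoc, ← mul_assoc, trace_mul_comm]
    have h4 : (a i * xᵀ * (x * (a i)ᵀ)).trace = (xᵀ * x * ((a i)ᵀ * a i)).trace := by
      rw [mul_assoc, trace_mul_comm]; simp only [mul_assoc]
    have h5 : (x * xᵀ * ((a i)ᵀ * a i)).trace = (xᵀ * x * (a i * (a i)ᵀ)).trace := by
      rw [mul_assoc, ← mul_assoc xᵀ, ← hxT, trace_mul_comm, mul_assoc, mul_assoc, ← hx,
        trace_mul_comm]
      simp only [mul_assoc]
    simp only [mul_sub, sub_mul, trace_sub, h1, h2, h3, h4, h5]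
  have hsum : ∑ i, ((xᵀ * a i - a i * xᵀ) * (xᵀ * a i - a i * xᵀ)ᵀ).trace = 0 := by
    simp only [key]
    rw [← trace_sum, ← Finset.mul_sum, ha, mul_zero, trace_zero]
  have h0 := (Finset.sum_eq_zero_iff_of_nonneg
    fun i _ => trace_mul_transpose_self_nonneg _).1 hsum i (Finset.mem_univ i)
  exact sub_eq_zero.1 (eq_zero_of_trace_mul_transpose_self h0)

variable [DecidableEq n]

attribute [local instance] Matrix.linftyOpNormedRing Matrix.linftyOpNormedAlgebra

theorem hasDerivAt_exp_conj (X a : Matrix n n ℝ) :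
    HasDerivAt (fun t : ℝ => NormedSpace.exp (t • X) * a * NormedSpace.exp (t • -X))
      (X * a - a * X) 0 := by
  have h1 := hasDerivAt_exp_smul_const (𝕂 := ℝ) X (0 : ℝ)
  have h2 := hasDerivAt_exp_smul_const (𝕂 := ℝ) (-X) (0 : ℝ)
  have := (h1.mul_const a).mul h2
  have e : NormedSpace.exp ((0 : ℝ) • X) * X * a * NormedSpace.exp ((0 : ℝ) • -X) +
      NormedSpace.exp ((0 : ℝ) • X) * a * (NormedSpace.exp ((0 : ℝ) • -X) * -X) =
      X * a - a * X := by
    simp [sub_eq_add_neg]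
  exact this.congr_deriv e

end MomentMap

/-! ### Critical points of the norm on a conjugation orbit. -/

section Minimality

variable {n ι : Type*} [Fintype n] [DecidableEq n] [Fintype ι]

/-- At a tuple of minimal norm in its conjugation orbit the moment map vanishes. -/
theorem sum_commutator_eq_zero_of_minimal {a : ι → Matrix n n ℝ}
    (hmin : ∀ g : (Matrix n n ℝ)ˣ, ∑ i, ∑ j, ∑ k, a i j k ^ 2 ≤
      ∑ i, ∑ j, ∑ k, (g.val * a i * g⁻¹.val) j k ^ 2) :
    ∑ i, (a i * (a i)ᵀ - (a i)ᵀ * a i) = 0 := by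
  -- The value of the moment map serves as the direction of the one-parameter group `exp (t • X)`:
  -- the squared norm along it has derivative `2 tr (X * X)` at `0`, and `X` is symmetric.
  set X := ∑ i, (a i * (a i)ᵀ - (a i)ᵀ * a i) with hX
  have hXT : Xᵀ = X := by simp [hX, transpose_sum]
  let γ : ι → ℝ → Matrix n n ℝ := fun i t =>
    NormedSpace.exp (t • X) * a i * NormedSpace.exp (t • -X)
  have hγ0 : ∀ i, γ i 0 = a i := fun i => by simp [γ]
  have hγ : ∀ i j k, HasDerivAt (fun t => γ i t j k) ((X * a i - a i * X) j k) 0 := by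
    intro i j k
    have h := hasDerivAt_exp_conj X (a i)
    exact hasDerivAt_pi.1 (hasDerivAt_pi.1 h j) k
  have hf : HasDerivAt (fun t => ∑ i, ∑ j, ∑ k, γ i t j k ^ 2)
      (∑ i, ∑ j, ∑ k, 2 * (a i j k * (X * a i - a i * X) j k)) 0 := by
    refine HasDerivAt.fun_sum fun i _ => HasDerivAt.fun_sum fun j _ => HasDerivAt.fun_sum fun k _ => ?_
    refine ((hγ i j k).fun_pow 2).congr_deriv ?_
    rw [hγ0]
    simp [mul_assoc]
  have hlm : IsLocalMin (fun t => ∑ i, ∑ j, ∑ k, γ i t j k ^ 2) 0 := by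
    refine Filter.Eventually.of_forall fun t => ?_
    change ∑ i, ∑ j, ∑ k, γ i 0 j k ^ 2 ≤ ∑ i, ∑ j, ∑ k, γ i t j k ^ 2
    simp only [hγ0]
    have e1 : NormedSpace.exp (t • X) * NormedSpace.exp (t • -X) = 1 := by
      rw [← Matrix.exp_add_of_commute]
      · simp
      · exact ((Commute.refl X).neg_right.smul_left t).smul_right t
    have e2 : NormedSpace.exp (t • -X) * NormedSpace.exp (t • X) = 1 := by
      rw [← Matrix.exp_add_of_commute]
      · simp
      · exact ((Commute.refl X).neg_left.smul_left t).smul_right t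
    exact hmin ⟨_, _, e1, e2⟩
  have h0 := hlm.hasDerivAt_eq_zero hf
  simp only [← Finset.mul_sum] at h0
  have h1 : (X * X).trace = 0 := by
    have h2 : ∑ i, ∑ j, ∑ k, a i j k * (X * a i - a i * X) j k = 0 := by simpa using h0
    simp only [← trace_transpose_mul_eq_sum] at h2
    rw [← h2, ← trace_sum]
    conv_lhs => rw [hX, ← hX, Finset.mul_sum]
    simp only [trace_sum]
    refine Finset.sum_congr rfl fun i _ => ?_
    simp only [mul_sub, trace_sub]
    congr 1
    · rw [← mul_assoc, trace_mul_comm, ← mul_assoc, trace_mul_comm]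
    · rw [← mul_assoc, trace_mul_comm, ← mul_assoc, trace_mul_comm]
  exact eq_zero_of_trace_mul_transpose_self (by rw [hXT, h1])
end Minimality

/-! ### Closed orbits and points of least norm. -/

section ConjugationOrbit

variable {n ι A : Type*} [Fintype ι] [Ring A] [Algebra ℝ A]

theorem continuous_basis_constr (b : Module.Basis ι ℝ A) (a : A) :
    Continuous fun r : ι → Matrix n n ℝ => b.constr ℝ r a := by
  simp only [Module.Basis.constr_apply_fintype]
  fun_prop

variable [Fintype n] [DecidableEq n]

/-- The conjugation orbit of a representation of a separable algebra is closed. -/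
theorem isClosed_conj_orbit (b : Module.Basis ι ℝ A) {y : ι → A} (hy : ∑ i, b i * y i = 1)
    (hcas : ∀ a : A, ∑ i, TensorProduct.tmul ℝ (a * b i) (y i) =
      ∑ i, TensorProduct.tmul ℝ (b i) (y i * a)) (ρ : A →ₐ[ℝ] Matrix n n ℝ) :
    IsClosed {r : ι → Matrix n n ℝ | ∃ g : (Matrix n n ℝ)ˣ, ∀ i, r i = g * ρ (b i) * g⁻¹.val} := by
  set O := {r : ι → Matrix n n ℝ | ∃ g : (Matrix n n ℝ)ˣ, ∀ i, r i = g * ρ (b i) * g⁻¹.val}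
  have hO : ∀ r (g : (Matrix n n ℝ)ˣ), (∀ i, r i = g * ρ (b i) * g⁻¹.val) → ∀ a,
      b.constr ℝ r a = g * ρ a * g⁻¹.val := by
    intro r g hr a
    rw [Module.Basis.constr_apply_fintype]
    conv_rhs => rw [← b.sum_equivFun a]
    simp only [hr, map_sum, map_smul, Finset.mul_sum, Finset.sum_mul, mul_smul_comm,
      smul_mul_assoc]
  refine isClosed_of_closure_subset fun r hr => ?_
  have hmul : ∀ a c, b.constr ℝ r (a * c) = b.constr ℝ r a * b.constr ℝ r c := by
    intro a c
    have hcl : IsClosed {r : ι → Matrix n n ℝ |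
        b.constr ℝ r (a * c) = b.constr ℝ r a * b.constr ℝ r c} :=
      isClosed_eq (continuous_basis_constr b _)
        ((continuous_basis_constr b _).mul (continuous_basis_constr b _))
    refine closure_minimal ?_ hcl hr
    rintro r' ⟨g, hg⟩
    change b.constr ℝ r' (a * c) = b.constr ℝ r' a * b.constr ℝ r' c
    rw [hO r' g hg, hO r' g hg, hO r' g hg, map_mul]
    simp only [mul_assoc, Units.inv_mul_cancel_left]
  have hone : b.constr ℝ r 1 = 1 := by
    have hcl : IsClosed {r : ι → Matrix n n ℝ | b.constr ℝ r 1 = 1} :=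
      isClosed_eq (continuous_basis_constr b _) continuous_const
    refine closure_minimal ?_ hcl hr
    rintro r' ⟨g, hg⟩
    change b.constr ℝ r' 1 = 1
    rw [hO r' g hg, map_one, mul_one, Units.mul_inv]
  -- By Casimir invariance `T r'` intertwines `r'` with the limit representation `r`. Since `T r =
  -- 1`, it is invertible for `r'` near `r`, and some such `r'` lies in the orbit.
  let T : (ι → Matrix n n ℝ) → Matrix n n ℝ := fun r' => ∑ i, r i * b.constr ℝ r' (y i)
  have hTcont : Continuous T :=
    continuous_finsetSum _ fun i _ => continuous_const.mul (continuous_basis_constr b _)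
  have hTr : T r = 1 := by
    rw [← hone, ← hy, map_sum]
    refine Finset.sum_congr rfl fun i _ => ?_
    rw [hmul, Module.Basis.constr_basis]
  have hopen : IsOpen {r' | (T r').det ≠ 0} :=
    isOpen_ne.preimage (Continuous.matrix_det hTcont)
  obtain ⟨r', hdet, g, hg⟩ := mem_closure_iff.1 hr _ hopen (by simp [hTr])
  have hint : ∀ a, b.constr ℝ r a * T r' = T r' * b.constr ℝ r' a := by
    intro a
    have h := sum_bilin_casimir (hcas a) ((LinearMap.mul ℝ (Matrix n n ℝ)).compl₁₂
      (b.constr ℝ r) (b.constr ℝ r'))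
    simp only [LinearMap.compl₁₂_apply, LinearMap.mul_apply', hmul,
      Module.Basis.constr_basis] at h
    simp only [T, Finset.mul_sum, Finset.sum_mul, ← mul_assoc] at h ⊢
    rw [h]
    refine Finset.sum_congr rfl fun i _ => ?_
    rw [hO r' g hg, hO r' g hg, hO r' g hg, map_mul]
    simp only [mul_assoc, Units.inv_mul_cancel_left]
  obtain ⟨u, hu⟩ := (Matrix.isUnit_iff_isUnit_det _).2 (isUnit_iff_ne_zero.2 hdet)
  refine ⟨u * g, fun i => ?_⟩
  have h := hint (b i)
  rw [← hu, hO r' g hg, Module.Basis.constr_basis] at h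
  rw [(Units.eq_mul_inv_iff_mul_eq u).2 h]
  simp [mul_assoc]

theorem exists_minimal_of_isClosed {n ι : Type*} [Fintype n] [Fintype ι] {O : Set (ι → Matrix n n ℝ)} (hO : IsClosed O)
    (hne : O.Nonempty) :
    ∃ r ∈ O, ∀ s ∈ O, ∑ i, ∑ j, ∑ k, r i j k ^ 2 ≤ ∑ i, ∑ j, ∑ k, s i j k ^ 2 := by
  let f : (ι → n → n → ℝ) → ℝ := fun r => ∑ i, ∑ j, ∑ k, r i j k ^ 2
  have hf : Continuous f := by fun_prop
  obtain ⟨r₀, hr₀⟩ := hne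
  have hle : ∀ (r : ι → n → n → ℝ) i j k, r i j k ^ 2 ≤ f r := by
    intro r i j k
    refine le_trans ?_ (Finset.single_le_sum (f := fun i => ∑ j, ∑ k, r i j k ^ 2)
      (fun i _ => by positivity) (Finset.mem_univ i))
    refine le_trans ?_ (Finset.single_le_sum (f := fun j => ∑ k, r i j k ^ 2)
      (fun i _ => by positivity) (Finset.mem_univ j))
    exact Finset.single_le_sum (f := fun k => r i j k ^ 2)
      (fun i _ => by positivity) (Finset.mem_univ k)
  have hbdd : Bornology.IsBounded {r : ι → n → n → ℝ | f r ≤ f r₀} := by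
    refine (Metric.isBounded_closedBall (x := (0 : ι → n → n → ℝ)) (r := √(f r₀))).subset ?_
    intro r hr
    rw [mem_closedBall_zero_iff]
    have h0 := Real.sqrt_nonneg (f r₀)
    refine (pi_norm_le_iff_of_nonneg h0).2 fun i => (pi_norm_le_iff_of_nonneg h0).2 fun j =>
      (pi_norm_le_iff_of_nonneg h0).2 fun k => ?_
    exact Real.abs_le_sqrt ((hle r i j k).trans hr)
  -- On the underlying function type the sup norm is available and the topology is the same.
  have hO' : IsClosed (X := ι → n → n → ℝ) O := hO
  have hcomp : IsCompact (X := ι → n → n → ℝ) (O ∩ {r : ι → n → n → ℝ | f r ≤ f r₀}) :=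
    Metric.isCompact_of_isClosed_isBounded (hO'.inter (isClosed_le hf continuous_const))
      (hbdd.subset Set.inter_subset_right)
  obtain ⟨r, hr, hmin⟩ := hcomp.exists_isMinOn ⟨r₀, hr₀, le_refl (f r₀)⟩ hf.continuousOn
  refine ⟨r, hr.1, fun s hs => ?_⟩
  by_cases h : f s ≤ f r₀
  · exact hmin ⟨hs, h⟩
  · exact le_trans hr.2 (le_of_not_ge h)

/-- A representation of a semisimple algebra can be conjugated so that its commutant becomes stable
under transposition. -/
theorem exists_conj_commutant_transpose [FiniteDimensional ℝ A] [IsSemisimpleRing A]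
    (ρ : A →ₐ[ℝ] Matrix n n ℝ) :
    ∃ g : (Matrix n n ℝ)ˣ, ∀ x : Matrix n n ℝ,
      (∀ a, x * (g * ρ a * g⁻¹.val) = g * ρ a * g⁻¹.val * x) →
        ∀ a, xᵀ * (g * ρ a * g⁻¹.val) = g * ρ a * g⁻¹.val * xᵀ := by
  let b := Module.finBasis ℝ A
  obtain ⟨y, hy, hcas⟩ := exists_casimir b
  obtain ⟨r, ⟨g, hg⟩, hmin⟩ := exists_minimal_of_isClosed (isClosed_conj_orbit b hy hcas ρ)
    ⟨fun i => ρ (b i), 1, by simp⟩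
  have hmom := sum_commutator_eq_zero_of_minimal (a := r) fun h =>
    hmin _ ⟨h * g, fun i => by simp [hg i, mul_assoc]⟩
  refine ⟨g, fun x hx a => ?_⟩
  have hc := commute_transpose_of_sum_commutator_eq_zero hmom (x := x) fun i => by
    rw [hg]; exact hx _
  simp only [hg] at hc
  rw [← b.sum_repr a]
  simp only [map_sum, map_smul, Finset.mul_sum, Finset.sum_mul, mul_smul_comm, smul_mul_assoc, hc]

end ConjugationOrbit

/-! ### Inner products from linear coordinates. -/

section MatrixCoordinates

variable {W n : Type*} [AddCommGroup W] [Module ℝ W] [Fintype n]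

/-- The inner product for which the given linear coordinates are orthonormal. -/
noncomputable def coordinateForm (f : W ≃ₗ[ℝ] (n → ℝ)) : LinearMap.BilinForm ℝ W :=
  LinearMap.mk₂ ℝ (fun u v => f u ⬝ᵥ f v) (by simp) (by simp) (by simp) (by simp)

theorem coordinateForm_apply (f : W ≃ₗ[ℝ] (n → ℝ)) (u v : W) :
    coordinateForm f u v = f u ⬝ᵥ f v := rfl

theorem coordinateForm_isSymm (f : W ≃ₗ[ℝ] (n → ℝ)) : (coordinateForm f).IsSymm :=
  ⟨fun _ _ => dotProduct_comm _ _⟩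

theorem coordinateForm_pos (f : W ≃ₗ[ℝ] (n → ℝ)) {v : W} (hv : v ≠ 0) :
    0 < coordinateForm f v v :=
  lt_of_le_of_ne (Finset.sum_nonneg fun _ _ => mul_self_nonneg _) fun h =>
    hv (f.map_eq_zero_iff.1 (dotProduct_self_eq_zero.1 h.symm))

variable [DecidableEq n]

/-- The algebra isomorphism from endomorphisms to matrices given by linear coordinates. -/
noncomputable def endToMatrix (f : W ≃ₗ[ℝ] (n → ℝ)) : Module.End ℝ W ≃ₐ[ℝ] Matrix n n ℝ :=
  (f.conjAlgEquiv ℝ).trans LinearMap.toMatrixAlgEquiv'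

theorem endToMatrix_mulVec (f : W ≃ₗ[ℝ] (n → ℝ)) (x : Module.End ℝ W) (u : W) :
    endToMatrix f x *ᵥ f u = f (x u) := by
  change LinearMap.toMatrix' (f.conjAlgEquiv ℝ x) *ᵥ f u = _
  rw [LinearMap.toMatrix'_mulVec]
  simp [LinearEquiv.conjAlgEquiv_apply]

theorem coordinateForm_adjoint (f : W ≃ₗ[ℝ] (n → ℝ)) (x : Module.End ℝ W) (u v : W) :
    coordinateForm f (x u) v = coordinateForm f u ((endToMatrix f).symm (endToMatrix f x)ᵀ v) := by
  rw [coordinateForm_apply, coordinateForm_apply, ← endToMatrix_mulVec, ← endToMatrix_mulVec,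
    AlgEquiv.apply_symm_apply, dotProduct_mulVec, vecMul_transpose]

/-- The commutant of a semisimple algebra of endomorphisms is self-adjoint for some inner
product. -/
theorem exists_form_commutant_selfAdjoint [FiniteDimensional ℝ W]
    (A : Subalgebra ℝ (Module.End ℝ W)) [IsSemisimpleRing A] :
    ∃ B : LinearMap.BilinForm ℝ W, B.IsSymm ∧ (∀ v, v ≠ 0 → 0 < B v v) ∧
      ∀ x ∈ Subalgebra.centralizer ℝ (A : Set (Module.End ℝ W)),
        ∃ y ∈ Subalgebra.centralizer ℝ (A : Set (Module.End ℝ W)),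
          ∀ u v, B (x u) v = B u (y v) := by
  let f₀ := (Module.finBasis ℝ W).equivFun
  obtain ⟨g, hg⟩ := exists_conj_commutant_transpose
    ((endToMatrix f₀).toAlgHom.comp A.val)
  let e : (Fin (Module.finrank ℝ W) → ℝ) ≃ₗ[ℝ] (Fin (Module.finrank ℝ W) → ℝ) :=
    LinearEquiv.ofLinearMap (toLin' g.val) (toLin' g⁻¹.val)
      (by rw [← toLin'_mul, Units.mul_inv, toLin'_one])
      (by rw [← toLin'_mul, Units.inv_mul, toLin'_one])
  -- In coordinates twisted by `g` the inclusion of `A` becomes the conjugated representation, and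
  -- transposition is the adjoint for `coordinateForm f`.
  let f := f₀.trans e
  have hf : ∀ x, endToMatrix f x = g.val * endToMatrix f₀ x * g⁻¹.val := by
    intro x
    refine Matrix.toLin'.injective (LinearMap.ext fun w => ?_)
    obtain ⟨u, rfl⟩ := f.surjective w
    rw [toLin'_apply, toLin'_apply, endToMatrix_mulVec]
    change g.val *ᵥ f₀ (x u) = (g.val * endToMatrix f₀ x * g⁻¹.val) *ᵥ (g.val *ᵥ f₀ u)
    rw [mulVec_mulVec, Units.inv_mul_cancel_right, ← mulVec_mulVec, endToMatrix_mulVec]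
  refine ⟨coordinateForm f, coordinateForm_isSymm f, fun v => coordinateForm_pos f, fun x hx => ?_⟩
  refine ⟨_, ?_, fun u v => coordinateForm_adjoint f x u v⟩
  rw [Subalgebra.mem_centralizer_iff] at hx ⊢
  intro a ha
  apply (endToMatrix f).injective
  rw [map_mul, map_mul, AlgEquiv.apply_symm_apply, hf a]
  refine (hg _ (fun a => ?_) ⟨a, ha⟩).symm
  change endToMatrix f x * (g.val * endToMatrix f₀ a * g⁻¹.val)
    = g.val * endToMatrix f₀ a * g⁻¹.val * endToMatrix f x
  rw [← hf, ← map_mul, ← map_mul, hx a a.2]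

end MatrixCoordinates

namespace AlgInvolution

variable {R E : Type*} [CommRing R] [Ring E] [Algebra R E] (σ : AlgInvolution R E)

theorem map_mul_rev (x y : E) : σ (x * y) = σ y * σ x := σ.map_mul_rev' x y

theorem apply_apply (x : E) : σ (σ x) = x := σ.map_map' x

theorem map_one : σ 1 = 1 := by
  have h := σ.map_mul_rev (σ 1) 1
  rwa [mul_one, apply_apply, mul_one, eq_comm] at h

instance : LinearMapClass (AlgInvolution R E) R E E where
  map_add σ x y := σ.map_add' x y
  map_smulₛₗ σ r x := σ.map_smul' r x

theorem stabilizes_iff {A : Subalgebra R E} : σ.Stabilizes A ↔ ∀ x ∈ A, σ x ∈ A := by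
  constructor
  · intro h x hx
    have : σ x ∈ σ '' (A : Set E) := ⟨x, hx, rfl⟩
    rwa [h] at this
  · intro h
    ext x
    exact ⟨fun ⟨y, hy, hyx⟩ => hyx ▸ h y hy, fun hx => ⟨σ x, h x hx, σ.apply_apply x⟩⟩

/-- If an involution stabilizes a subalgebra, it stabilizes its centralizer. -/
theorem map_mem_centralizer {A : Subalgebra R E} (h : ∀ x ∈ A, σ x ∈ A) {y : E}
    (hy : y ∈ Subalgebra.centralizer R (A : Set E)) :
    σ y ∈ Subalgebra.centralizer R (A : Set E) := by
  rw [Subalgebra.mem_centralizer_iff] at hy ⊢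
  intro x hx
  have h1 := congrArg σ (hy (σ x) (h x hx))
  rwa [map_mul_rev, map_mul_rev, apply_apply, eq_comm] at h1

end AlgInvolution

/-! ### Exponentials of endomorphisms. -/

section Exponential

variable {W n : Type*} [AddCommGroup W] [Module ℝ W] [Fintype n] [DecidableEq n]

/-- The exponential of endomorphisms, computed in linear coordinates. -/
noncomputable def endExp (f : W ≃ₗ[ℝ] (n → ℝ)) (x : Module.End ℝ W) : Module.End ℝ W :=
  (endToMatrix f).symm (NormedSpace.exp (endToMatrix f x))

theorem endExp_zero (f : W ≃ₗ[ℝ] (n → ℝ)) : endExp f 0 = 1 := by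
  simp [endExp]

theorem endExp_add (f : W ≃ₗ[ℝ] (n → ℝ)) {x y : Module.End ℝ W} (h : Commute x y) :
    endExp f (x + y) = endExp f x * endExp f y := by
  rw [endExp, map_add, Matrix.exp_add_of_commute _ _ (h.map (endToMatrix f)), map_mul]
  rfl

/-- The exponential as a unit. -/
noncomputable def endExpUnit (f : W ≃ₗ[ℝ] (n → ℝ)) (x : Module.End ℝ W) : (Module.End ℝ W)ˣ where
  val := endExp f x
  inv := endExp f (-x)
  val_inv := by
    rw [← endExp_add f (Commute.refl x).neg_right, add_neg_cancel, endExp_zero]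
  inv_val := by
    rw [← endExp_add f (Commute.refl x).neg_left, neg_add_cancel, endExp_zero]

attribute [local instance] Matrix.linftyOpNormedRing Matrix.linftyOpNormedAlgebra

theorem Subalgebra.matrix_exp_mem (S : Subalgebra ℝ (Matrix n n ℝ)) {x : Matrix n n ℝ}
    (hx : x ∈ S) : NormedSpace.exp x ∈ S := by
  have hcl : IsClosed (S.toSubmodule : Set (Matrix n n ℝ)) := Submodule.closed_of_finiteDimensional _
  exact NormedSpace.exp_mem (s := S) hcl hx

theorem endExp_mem (f : W ≃ₗ[ℝ] (n → ℝ)) {A : Subalgebra ℝ (Module.End ℝ W)}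
    {x : Module.End ℝ W} (hx : x ∈ A) : endExp f x ∈ A := by
  have h := (A.map (endToMatrix f).toAlgHom).matrix_exp_mem (x := endToMatrix f x) ⟨x, hx, rfl⟩
  obtain ⟨y, hy, hxy⟩ := h
  have : endExp f x = y := by
    rw [endExp, ← hxy]
    exact (endToMatrix f).symm_apply_apply y
  rwa [this]

/-- An anti-automorphism is a ring homomorphism to the opposite algebra, continuous by finite
dimensionality, so it commutes with the exponential series. -/
theorem AlgInvolution.apply_endExp (f : W ≃ₗ[ℝ] (n → ℝ)) (τ : AlgInvolution ℝ (Module.End ℝ W))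
    (x : Module.End ℝ W) : τ (endExp f x) = endExp f (τ x) := by
  let φ : Matrix n n ℝ →ₗ[ℝ] Matrix n n ℝ :=
    (endToMatrix f).toLinearMap ∘ₗ τ.toLinearMap ∘ₗ (endToMatrix f).symm.toLinearMap
  have hφ : ∀ y, φ y = endToMatrix f (τ ((endToMatrix f).symm y)) := fun y => rfl
  let ψ : Matrix n n ℝ →+* (Matrix n n ℝ)ᵐᵒᵖ :=
    { toFun := fun y => MulOpposite.op (φ y)
      map_one' := by rw [hφ, _root_.map_one, τ.map_one, _root_.map_one]; rfl
      map_zero' := by rw [map_zero]; rfl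
      map_add' := fun y z => by rw [map_add]; rfl
      map_mul' := fun y z => by
        rw [← MulOpposite.op_mul, hφ, hφ, hφ, map_mul, τ.map_mul_rev, map_mul] }
  have hψ : Continuous ψ :=
    MulOpposite.continuous_op.comp (LinearMap.continuous_of_finiteDimensional φ)
  have h := NormedSpace.map_exp ψ hψ (endToMatrix f x)
  have h2 : φ (NormedSpace.exp (endToMatrix f x)) = NormedSpace.exp (φ (endToMatrix f x)) :=
    MulOpposite.op_injective (h.trans (NormedSpace.exp_op _))
  rw [hφ, hφ, AlgEquiv.symm_apply_apply] at h2
  apply (endToMatrix f).injective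
  rw [endExp, h2, endExp, AlgEquiv.apply_symm_apply]

end Exponential

/-! ### Logarithms of positive operators and inner derivations. -/

section Logarithm

variable {W : Type*} [AddCommGroup W] [Module ℝ W] [FiniteDimensional ℝ W]

/-- The spectral theorem for a positive-definite form. -/
theorem exists_diagonalizing_coordinates {B : LinearMap.BilinForm ℝ W} (hB : B.IsSymm)
    (hpos : ∀ v, v ≠ 0 → 0 < B v v) {P : Module.End ℝ W} (hP : ∀ u v, B (P u) v = B u (P v)) :
    ∃ (f : W ≃ₗ[ℝ] (Fin (Module.finrank ℝ W) → ℝ)) (l : Fin (Module.finrank ℝ W) → ℝ),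
      (∀ u v, B u v = f u ⬝ᵥ f v) ∧ ∀ u, f (P u) = fun i => l i * f u i := by
  let c : InnerProductSpace.Core ℝ W :=
    { inner := fun u v => B u v
      conj_inner_symm := fun u v => hB.eq v u
      re_inner_nonneg := fun v => by
        by_cases h : v = 0
        · simp [h]
        · exact (hpos v h).le
      add_left := fun u v w => by simp
      smul_left := fun u v r => by simp
      definite := fun v h => by
        by_contra hv
        exact (hpos v hv).ne' h }
  let _ : NormedAddCommGroup W := c.toNormedAddCommGroup
  let _ : InnerProductSpace ℝ W := InnerProductSpace.ofCore c.toCore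
  have hsymm : LinearMap.IsSymmetric P := hP
  let e := hsymm.eigenvectorBasis rfl
  refine ⟨e.repr.toLinearEquiv.trans (WithLp.linearEquiv 2 ℝ _), hsymm.eigenvalues rfl,
    fun u v => ?_, fun u => ?_⟩
  · have h := e.repr.inner_map_map u v
    change _ = B u v at h
    rw [← h, PiLp.inner_apply]
    refine Finset.sum_congr rfl fun i _ => ?_
    simp [mul_comm]
  · ext i
    exact hsymm.eigenvectorBasis_apply_self_apply rfl u i

omit [FiniteDimensional ℝ W] in
theorem endToMatrix_eq_diagonal_iff {n : Type*} [Fintype n] [DecidableEq n] (f : W ≃ₗ[ℝ] (n → ℝ))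
    (P : Module.End ℝ W) (l : n → ℝ) :
    endToMatrix f P = diagonal l ↔ ∀ u, f (P u) = fun i => l i * f u i := by
  constructor
  · intro h u
    rw [← endToMatrix_mulVec, h]
    ext i
    rw [mulVec_diagonal]
  · intro h
    refine Matrix.toLin'.injective (LinearMap.ext fun w => ?_)
    obtain ⟨u, rfl⟩ := f.surjective w
    rw [toLin'_apply, toLin'_apply, endToMatrix_mulVec, h]
    ext i
    rw [mulVec_diagonal]

/-- The logarithm of a positive-definite operator. -/
theorem exists_log {B : LinearMap.BilinForm ℝ W} (hB : B.IsSymm)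
    (hpos : ∀ v, v ≠ 0 → 0 < B v v) {P : Module.End ℝ W} (hP : ∀ u v, B (P u) v = B u (P v))
    (hPpos : ∀ v, v ≠ 0 → 0 < B (P v) v) :
    ∃ (f : W ≃ₗ[ℝ] (Fin (Module.finrank ℝ W) → ℝ)) (L : Module.End ℝ W), endExp f L = P ∧
      (∀ u v, B (L u) v = B u (L v)) ∧ (∀ y, P * y = y * P → L * y = y * L) ∧
      (∀ y, P * y * P = y → L * y = -(y * L)) ∧
      ∀ A : Subalgebra ℝ (Module.End ℝ W), (∀ x ∈ A, ∃ y ∈ A, P * x = y * P) →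
        ∀ x ∈ A, L * x - x * L ∈ A := by
  obtain ⟨f, l, hf, hl⟩ := exists_diagonalizing_coordinates hB hpos hP
  have hlpos : ∀ i, 0 < l i := by
    intro i
    have hne : f.symm (Pi.single i 1) ≠ 0 := by simp
    have h := hPpos _ hne
    rw [hf, hl] at h
    simpa [dotProduct, Pi.single_apply] using h
  set Φ := endToMatrix f
  have hPd : Φ P = diagonal l := (endToMatrix_eq_diagonal_iff f P l).2 hl
  set L := Φ.symm (diagonal fun i => Real.log (l i)) with hL
  have hLd : Φ L = diagonal fun i => Real.log (l i) := Φ.apply_symm_apply _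
  have hLf := (endToMatrix_eq_diagonal_iff f L _).1 hLd
  refine ⟨f, L, ?_, fun u v => ?_, fun y hy => ?_, fun y hy => ?_, fun A hA x hx => ?_⟩
  · apply Φ.injective
    change Φ (Φ.symm (NormedSpace.exp (Φ L))) = Φ P
    rw [Φ.apply_symm_apply, hLd, hPd, Matrix.exp_diagonal]
    congr 1
    ext i
    rw [Pi.coe_exp, ← Real.exp_eq_exp_ℝ, Real.exp_log (hlpos i)]
  · rw [hf, hf, hLf, hLf]
    refine Finset.sum_congr rfl fun i _ => ?_
    ring
  · apply Φ.injective
    have h := congrArg Φ hy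
    rw [map_mul, map_mul, hPd] at h
    rw [map_mul, map_mul, hLd]
    ext i j
    have hij := congrFun (congrFun h i) j
    rw [diagonal_mul, mul_diagonal] at hij ⊢
    by_cases h0 : Φ y i j = 0
    · simp [h0]
    · have : l i = l j := mul_right_cancel₀ h0 (hij.trans (mul_comm _ _))
      rw [this, mul_comm]
  · apply Φ.injective
    have h := congrArg Φ hy
    rw [map_mul, map_mul, hPd] at h
    rw [map_neg, map_mul, map_mul, hLd]
    ext i j
    have hij := congrFun (congrFun h i) j
    rw [mul_diagonal, diagonal_mul] at hij
    rw [Matrix.neg_apply, diagonal_mul, mul_diagonal]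
    by_cases h0 : Φ y i j = 0
    · simp [h0]
    · have h1 : l i * l j = 1 := mul_right_cancel₀ h0 (by linarith)
      have h2 := congrArg Real.log h1
      rw [Real.log_mul (hlpos i).ne' (hlpos j).ne', Real.log_one] at h2
      linear_combination Φ y i j * h2
  · set Q := Φ.symm (diagonal fun i => (l i)⁻¹)
    have hQd : Φ Q = diagonal fun i => (l i)⁻¹ := Φ.apply_symm_apply _
    have hPQ : P * Q = 1 := by
      apply Φ.injective
      rw [map_mul, hPd, hQd, diagonal_mul_diagonal, map_one, ← diagonal_one]
      congr 1
      ext i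
      exact mul_inv_cancel₀ (hlpos i).ne'
    have hstep : ∀ x ∈ A, P * x * Q ∈ A := by
      intro x hx
      obtain ⟨y, hy, h⟩ := hA x hx
      rwa [h, mul_assoc, hPQ, mul_one]
    have hpow : ∀ k : ℕ, P ^ k * x * Q ^ k ∈ A := by
      intro k
      induction k with
      | zero => simpa using hx
      | succ k ih =>
        have h := hstep _ ih
        rw [pow_succ', pow_succ]
        simpa only [mul_assoc] using h
    -- In eigencoordinates, conjugation by `P` scales the entry `(i, j)` by `l i / l j`, while `ad
    -- L` scales it by the logarithm of that quotient. Interpolating `Real.log` at these quotients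
    -- writes `ad L` as a polynomial in conjugation by `P`, which preserves `A`.
    let s : Finset ℝ := Finset.univ.image fun p : Fin (Module.finrank ℝ W) × Fin _ => l p.1 / l p.2
    let p := Lagrange.interpolate s id Real.log
    have hp : ∀ i j, p.eval (l i / l j) = Real.log (l i) - Real.log (l j) := by
      intro i j
      rw [← Real.log_div (hlpos i).ne' (hlpos j).ne']
      exact Lagrange.eval_interpolate_at_node (v := id) Real.log Function.injective_id.injOn
        (Finset.mem_image.2 ⟨(i, j), Finset.mem_univ _, rfl⟩)
    have hsum : L * x - x * L =
        ∑ k ∈ Finset.range (p.natDegree + 1), p.coeff k • (P ^ k * x * Q ^ k) := by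
      apply Φ.injective
      simp only [map_sub, map_sum, map_smul, map_mul, map_pow, hLd, hPd, hQd, diagonal_pow]
      ext i j
      rw [Matrix.sub_apply, diagonal_mul, mul_diagonal, Matrix.sum_apply]
      simp only [Matrix.smul_apply, mul_diagonal, diagonal_mul, Pi.pow_apply, smul_eq_mul]
      have : Real.log (l i) * Φ x i j - Φ x i j * Real.log (l j) =
        (p.eval (l i / l j)) * Φ x i j := by rw [hp]; ring
      rw [this, Polynomial.eval_eq_sum_range, Finset.sum_mul]
      refine Finset.sum_congr rfl fun k _ => ?_
      rw [div_eq_mul_inv, mul_pow]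
      ring
    rw [hsum]
    exact A.sum_mem fun k _ => A.smul_mem (hpow k) _

/-- Derivations of a semisimple subalgebra induced by an endomorphism are inner. -/
theorem exists_sub_mem_centralizer (A : Subalgebra ℝ (Module.End ℝ W)) [IsSemisimpleRing A]
    {L : Module.End ℝ W} (hL : ∀ x ∈ A, L * x - x * L ∈ A) :
    ∃ a ∈ A, L - a ∈ Subalgebra.centralizer ℝ (A : Set (Module.End ℝ W)) := by
  let b := Module.finBasis ℝ A
  obtain ⟨y, hy, hcas⟩ := exists_casimir b
  have hy' : ∑ i, (b i : Module.End ℝ W) * y i = 1 := by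
    simpa using congrArg Subtype.val hy
  -- With `D = [L, ·]`, Casimir invariance for `(c, d) ↦ D c * d` reads `D z + z * a = a * z`, where
  -- `a` is this sum.
  refine ⟨∑ i, (L * b i - b i * L) * y i,
    A.sum_mem fun i _ => A.mul_mem (hL _ (b i).2) (y i).2, ?_⟩
  rw [Subalgebra.mem_centralizer_iff]
  intro z hz
  let β : A →ₗ[ℝ] A →ₗ[ℝ] Module.End ℝ W :=
    (LinearMap.mul ℝ (Module.End ℝ W)).compl₁₂
      ((LinearMap.mulLeft ℝ L - LinearMap.mulRight ℝ L) ∘ₗ A.val.toLinearMap) A.val.toLinearMap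
  have h := sum_bilin_casimir (hcas ⟨z, hz⟩) β
  have hβ : ∀ c d : A, β c d = (L * c.val - c.val * L) * d.val := fun c d => rfl
  simp only [hβ, Subalgebra.coe_mul] at h
  have h1 : ∀ i, (L * (z * (b i).val) - z * (b i).val * L) * (y i).val =
      (L * z - z * L) * ((b i).val * (y i).val) + z * ((L * b i - b i * L) * y i) := by
    intro i
    noncomm_ring
  simp only [h1, Finset.sum_add_distrib, ← Finset.mul_sum, hy', mul_one] at h
  rw [mul_sub, sub_mul, Finset.sum_mul]
  simp only [mul_assoc] at h ⊢
  rw [← h]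
  noncomm_ring

end Logarithm

end MatrixMethods

/-! ### Compatibility of an inner product with the symplectic form. -/

section CartanInvolutions

variable {W : Type*} [AddCommGroup W] [Module ℝ W]

namespace LinearMap.BilinForm

theorem nondegenerate_of_pos {B : LinearMap.BilinForm ℝ W} (hpos : ∀ v, v ≠ 0 → 0 < B v v) :
    B.Nondegenerate := by
  constructor
  · intro v h
    by_contra hv
    exact (hpos v hv).ne' (h v)
  · intro v h
    by_contra hv
    exact (hpos v hv).ne' (h v)

theorem eq_of_forall_left {B : LinearMap.BilinForm ℝ W} (hB : B.Nondegenerate) {v w : W}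
    (h : ∀ u, B u v = B u w) : v = w := by
  rw [← sub_eq_zero]
  exact hB.2 _ fun u => by rw [map_sub, h, sub_self]

theorem eq_of_forall_right {B : LinearMap.BilinForm ℝ W} (hB : B.Nondegenerate) {v w : W}
    (h : ∀ u, B v u = B w u) : v = w := by
  rw [← sub_eq_zero]
  exact hB.1 _ fun u => by rw [map_sub, LinearMap.sub_apply, h, sub_self]

variable [FiniteDimensional ℝ W]

theorem exists_operator (B' : LinearMap.BilinForm ℝ W) {B : LinearMap.BilinForm ℝ W}
    (hB : B.Nondegenerate) : ∃ P : Module.End ℝ W, ∀ u v, B (P u) v = B' u v :=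
  ⟨B'.symmCompOfNondegenerate B hB, fun u v => B'.symmCompOfNondegenerate_left_apply hB v u⟩

theorem exists_involution {B : LinearMap.BilinForm ℝ W} (hB : B.Nondegenerate) (hs : B.IsSymm) :
    ∃ σ : AlgInvolution ℝ (Module.End ℝ W), ∀ x u v, B (x u) v = B u (σ x v) := by
  have hl : ∀ x u v, B (B.leftAdjointOfNondegenerate hB x u) v = B u (x v) :=
    fun x u v => leftAdjoint_spec B hB x u v
  have hr : ∀ x u v, B (x u) v = B u (B.leftAdjointOfNondegenerate hB x v) := fun x u v =>
    (hs.eq v (x u)).symm.trans ((hl x v u).symm.trans (hs.eq _ u))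
  refine ⟨{ toFun := fun x => B.leftAdjointOfNondegenerate hB x
            map_add' := fun x y => (eq_leftAdjoint B hB fun u v => ?_).symm
            map_smul' := fun r x => (eq_leftAdjoint B hB fun u v => ?_).symm
            map_mul_rev' := fun x y => (eq_leftAdjoint B hB fun u v => ?_).symm
            map_map' := fun x => (eq_leftAdjoint B hB fun u v => ?_).symm }, hr⟩
  · simp only [LinearMap.add_apply, map_add, hl]
  · simp only [LinearMap.smul_apply, map_smul, hl, RingHom.id_apply]
  · simp only [Module.End.mul_apply, hl]
  · exact hr x u v

omit [FiniteDimensional ℝ W] in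
theorem eq_of_adjoint {B : LinearMap.BilinForm ℝ W} (hB : B.Nondegenerate)
    {x y z : Module.End ℝ W} (hy : ∀ u v, B (x u) v = B u (y v))
    (hz : ∀ u v, B (x u) v = B u (z v)) : y = z :=
  LinearMap.ext fun v => eq_of_forall_left hB fun u => by rw [← hy, hz]

end LinearMap.BilinForm

variable [FiniteDimensional ℝ W]

open LinearMap.BilinForm

section Compatible

variable {ω : LinearMap.BilinForm ℝ W} {halt : ω.IsAlt} {hnd : ω.Nondegenerate}
  {B : LinearMap.BilinForm ℝ W} {σ : AlgInvolution ℝ (Module.End ℝ W)} {J : Module.End ℝ W}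

omit [FiniteDimensional ℝ W] in
theorem involution_apply_eq_neg (hs : B.IsSymm) (hB : B.Nondegenerate) (halt : ω.IsAlt)
    (hσ : ∀ x u v, B (x u) v = B u (σ x v)) (hJ : ∀ u v, B (J u) v = ω u v) : σ J = -J :=
  eq_of_adjoint hB (hσ J) fun u v => by
    rw [LinearMap.neg_apply, map_neg, hs.eq u, hJ, hJ, halt.neg_eq]

/-- Both adjoints of `x` are computed from `ω u v = B (J u) v`; as `J` is invertible, this
determines `τ` from `σ` and `J`. -/
theorem mul_symplecticAdjoint_eq (hs : B.IsSymm) (hB : B.Nondegenerate)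
    (hσ : ∀ x u v, B (x u) v = B u (σ x v)) (hJ : ∀ u v, B (J u) v = ω u v)
    (x : Module.End ℝ W) : J * symplecticAdjoint ω halt hnd x = σ x * J := by
  have h0 := involution_apply_eq_neg hs hB halt hσ hJ
  refine LinearMap.ext fun v => eq_of_forall_left hB fun u => ?_
  have h1 := symplecticAdjoint_spec ω halt hnd x u v
  rw [← hJ, ← hJ, hσ J, hσ J, h0, hσ x] at h1
  simpa using h1.symm

theorem isUnit_of_form (hnd : ω.Nondegenerate) (hJ : ∀ u v, B (J u) v = ω u v) : IsUnit J := by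
  rw [Module.End.isUnit_iff]
  have hinj : Function.Injective J := by
    refine (injective_iff_map_eq_zero J).2 fun u hu => hnd.1 u fun v => ?_
    rw [← hJ, hu, map_zero, LinearMap.zero_apply]
  exact ⟨hinj, LinearMap.injective_iff_surjective.1 hinj⟩

theorem comm_of_sq_eq_neg_one (hs : B.IsSymm) (hB : B.Nondegenerate)
    (hσ : ∀ x u v, B (x u) v = B u (σ x v)) (hJ : ∀ u v, B (J u) v = ω u v) (hJJ : J * J = -1) :
    ⇑σ ∘ ⇑(symplecticAdjoint ω halt hnd) = ⇑(symplecticAdjoint ω halt hnd) ∘ ⇑σ := by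
  have h0 := involution_apply_eq_neg hs hB halt hσ hJ
  have ht : ∀ x, symplecticAdjoint ω halt hnd x = -(J * σ x * J) := fun x => by
    rw [mul_assoc, ← mul_symplecticAdjoint_eq (halt := halt) (hnd := hnd) hs hB hσ hJ, ← mul_assoc,
      hJJ, neg_one_mul, neg_neg]
  funext x
  simp only [Function.comp_apply, ht, map_neg, σ.map_mul_rev, h0, σ.apply_apply]
  noncomm_ring

/-- Commutation makes `J * J` central, hence scalar. Its sign comes from `B (J v) (J v) = -B v (J (J
v))`. -/
theorem exists_sq_eq_smul_one_of_comm (hs : B.IsSymm) (hpos : ∀ v, v ≠ 0 → 0 < B v v)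
    (hnd : ω.Nondegenerate)
    (hσ : ∀ x u v, B (x u) v = B u (σ x v)) (hJ : ∀ u v, B (J u) v = ω u v)
    (hcomm : ⇑σ ∘ ⇑(symplecticAdjoint ω halt hnd) = ⇑(symplecticAdjoint ω halt hnd) ∘ ⇑σ) :
    ∃ c : ℝ, 0 < c ∧ J * J = -(c • (1 : Module.End ℝ W)) := by
  have hB := nondegenerate_of_pos hpos
  have h0 := involution_apply_eq_neg hs hB halt hσ hJ
  have hcen : ∀ x, J * J * x = x * (J * J) := by
    intro x
    have h1 := mul_symplecticAdjoint_eq (halt := halt) (hnd := hnd) hs hB hσ hJ (σ x)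
    have h2 := congrArg σ (mul_symplecticAdjoint_eq (halt := halt) (hnd := hnd) hs hB hσ hJ x)
    rw [← Function.comp_apply (f := symplecticAdjoint ω halt hnd), ← hcomm, σ.apply_apply] at h1
    rw [σ.map_mul_rev, σ.map_mul_rev, σ.apply_apply, h0] at h2
    simp only [Function.comp_apply] at h1
    have h3 : σ (symplecticAdjoint ω halt hnd x) * J = J * x := by simpa using h2
    rw [mul_assoc, ← h3, ← mul_assoc, h1, mul_assoc]
  have hmem : J * J ∈ Subalgebra.center ℝ (Module.End ℝ W) :=
    Subalgebra.mem_center_iff.2 fun x => (hcen x).symm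
  rw [Algebra.IsCentral.center_eq_bot] at hmem
  obtain ⟨c, hc⟩ := Algebra.mem_bot.1 hmem
  rw [Algebra.algebraMap_eq_smul_one] at hc
  rcases subsingleton_or_nontrivial W with hW | hW
  · exact ⟨1, one_pos, Subsingleton.elim _ _⟩
  · obtain ⟨v, hv⟩ := exists_ne (0 : W)
    refine ⟨-c, ?_, by rw [neg_smul, neg_neg, hc]⟩
    have hJv : J v ≠ 0 := fun h => hv
      (((Module.End.isUnit_iff J).1 (isUnit_of_form hnd hJ)).1 (h.trans (map_zero J).symm))
    have h1 := hpos _ hJv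
    have h2 : (J * J) v = c • v := by rw [← hc]; rfl
    rw [hσ J, h0, LinearMap.neg_apply, map_neg, ← Module.End.mul_apply, h2, map_smul,
      smul_eq_mul, ← neg_mul] at h1
    exact pos_of_mul_pos_left h1 (hpos v hv).le

/-- A Cartan involution commuting with the symplectic adjoint involution comes from an inner product
for which the symplectic form is given by a complex structure. -/
theorem exists_normalized_form (hσ : IsCartanInvolution σ)
    (hcomm : ⇑σ ∘ ⇑(symplecticAdjoint ω halt hnd) = ⇑(symplecticAdjoint ω halt hnd) ∘ ⇑σ) :
    ∃ (B : LinearMap.BilinForm ℝ W) (J : Module.End ℝ W), B.IsSymm ∧ (∀ v, v ≠ 0 → 0 < B v v) ∧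
      (∀ x u v, B (x u) v = B u (σ x v)) ∧ (∀ u v, B (J u) v = ω u v) ∧ J * J = -1 := by
  obtain ⟨B, hs, hpos, hadj⟩ := hσ
  obtain ⟨J, hJ⟩ := exists_operator ω (nondegenerate_of_pos hpos)
  obtain ⟨c, hc, hJJ⟩ := exists_sq_eq_smul_one_of_comm hs hpos hnd hadj hJ hcomm
  have hsc := Real.sqrt_pos.2 hc
  -- Scaling `B` and `J` by inverse factors changes neither `ω` nor the adjoint involution of `B`.
  refine ⟨√c • B, (√c)⁻¹ • J, ⟨fun u v => ?_⟩, fun v hv => ?_, fun x u v => ?_, fun u v => ?_, ?_⟩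
  · simp [hs.eq u v]
  · exact mul_pos hsc (hpos v hv)
  · simp [hadj x u v]
  · simp only [LinearMap.smul_apply, map_smul, smul_eq_mul, hJ]
    field_simp
  · rw [smul_mul_smul_comm, hJJ, ← mul_inv, Real.mul_self_sqrt hc.le, smul_neg, smul_smul,
      inv_mul_cancel₀ hc.ne', one_smul]

end Compatible

section ExponentialConjugation

variable {n : Type*} [Fintype n] [DecidableEq n] {f : W ≃ₗ[ℝ] (n → ℝ)} {L a : Module.End ℝ W}
  {A : Subalgebra ℝ (Module.End ℝ W)}

omit [FiniteDimensional ℝ W] in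
theorem commute_endExp {x : Module.End ℝ W} (h : Commute L x) :
    Commute (endExp f L) x := by
  have hL : L ∈ Subalgebra.centralizer ℝ {x} := by
    rw [Subalgebra.mem_centralizer_iff]
    rintro _ rfl
    exact h.eq.symm
  have := endExp_mem f hL
  rw [Subalgebra.mem_centralizer_iff] at this
  exact (this x rfl).symm

-- Since `a` commutes with `L - a`, `exp (tL) = exp (ta) exp (t(L - a))`. The second factor
-- centralizes `A`, so conjugation by `exp (tL)` acts on `A` as conjugation by an element of `A`.
omit [FiniteDimensional ℝ W] in
theorem endExp_conj_mem (ha : a ∈ A)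
    (hLa : L - a ∈ Subalgebra.centralizer ℝ (A : Set (Module.End ℝ W))) (t : ℝ)
    {x : Module.End ℝ W} (hx : x ∈ A) : endExp f (t • L) * x * endExp f (-(t • L)) ∈ A := by
  rw [Subalgebra.mem_centralizer_iff] at hLa
  have hc : ∀ y ∈ A, ∀ s : ℝ, Commute (s • (L - a)) y := fun y hy s =>
    (show Commute (L - a) y from (hLa y hy).symm).smul_left s
  have h1 : endExp f (t • L) = endExp f (t • a) * endExp f (t • (L - a)) := by
    rw [← endExp_add f (hc _ (A.smul_mem ha t) t).symm, ← smul_add, add_sub_cancel]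
  have h2 : endExp f (-(t • L)) = endExp f (-(t • (L - a))) * endExp f (-(t • a)) := by
    rw [← neg_smul, ← neg_smul, ← neg_smul, ← endExp_add f (hc _ (A.smul_mem ha _) _), ← smul_add,
      sub_add_cancel]
  have h3 : endExp f (t • (L - a)) * endExp f (-(t • (L - a))) = 1 :=
    (endExpUnit f (t • (L - a))).val_inv
  have h4 : endExp f (t • (L - a)) * x = x * endExp f (t • (L - a)) :=
    (commute_endExp (hc x hx t)).eq
  have h5 : endExp f (t • L) * x * endExp f (-(t • L)) =
      endExp f (t • a) * x * endExp f (-(t • a)) := by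
    rw [h1, h2]
    calc _ = endExp f (t • a) * (endExp f (t • (L - a)) * x) * endExp f (-(t • (L - a))) *
          endExp f (-(t • a)) := by noncomm_ring
      _ = endExp f (t • a) * x * (endExp f (t • (L - a)) * endExp f (-(t • (L - a)))) *
          endExp f (-(t • a)) := by rw [h4]; noncomm_ring
      _ = _ := by rw [h3, mul_one]
  rw [h5]
  exact A.mul_mem (A.mul_mem (endExp_mem f (A.smul_mem ha t)) hx)
    (endExp_mem f (A.neg_mem (A.smul_mem ha t)))

end ExponentialConjugation

/-! ### Existence of an adapted Cartan involution. -/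

section Existence

variable {ω : LinearMap.BilinForm ℝ W} {halt : ω.IsAlt} {hnd : ω.Nondegenerate}
  {A A' : Subalgebra ℝ (Module.End ℝ W)}

theorem exists_adaptedCartanInvolution (hpair : IsDualPairOfAlgebras ω halt hnd A A') :
    ∃ σ : AlgInvolution ℝ (Module.End ℝ W), IsAdaptedCartanInvolution ω halt hnd A A' σ := by
  have := hpair.semisimple_left
  obtain ⟨B, hs, hpos, hcent⟩ := exists_form_commutant_selfAdjoint A
  have hB := nondegenerate_of_pos hpos
  obtain ⟨σ, hσ⟩ := exists_involution hB hs
  have hσA : ∀ x ∈ A, σ x ∈ A := by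
    have hσA' : ∀ x ∈ A', σ x ∈ A' := by
      rw [← hpair.centralizer_left]
      intro x hx
      obtain ⟨y, hy, h⟩ := hcent x hx
      rwa [eq_of_adjoint hB (hσ x) h]
    intro x hx
    rw [← hpair.centralizer_right] at hx ⊢
    exact σ.map_mem_centralizer hσA' hx
  obtain ⟨J, hJ⟩ := exists_operator ω hB
  have hσJ := involution_apply_eq_neg hs hB halt hσ hJ
  have hJu := isUnit_of_form hnd hJ
  have hτA := (AlgInvolution.stabilizes_iff _).1 hpair.stable_left
  have hJA : ∀ x ∈ A, ∃ y ∈ A, J * x = y * J := fun x hx => by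
    refine ⟨_, hσA _ (hτA x hx), ?_⟩
    rw [← mul_symplecticAdjoint_eq (halt := halt) (hnd := hnd) hs hB hσ hJ,
      AlgInvolution.apply_apply]
  have hPA : ∀ x ∈ A, ∃ y ∈ A, -(J * J) * x = y * -(J * J) := fun x hx => by
    obtain ⟨y, hy, hxy⟩ := hJA x hx
    obtain ⟨z, hz, hyz⟩ := hJA y hy
    refine ⟨z, hz, ?_⟩
    rw [neg_mul, mul_assoc, hxy, ← mul_assoc, hyz, mul_neg, mul_assoc]
  have hPs : ∀ u v, B ((-(J * J)) u) v = B u ((-(J * J)) v) := fun u v => by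
    rw [hσ, map_neg, σ.map_mul_rev, hσJ, neg_mul_neg]
  have hPpos : ∀ v, v ≠ 0 → 0 < B ((-(J * J)) v) v := fun v hv => by
    have h : B ((-(J * J)) v) v = B (J v) (J v) := by
      rw [LinearMap.neg_apply, Module.End.mul_apply, map_neg, LinearMap.neg_apply, hσ J, hσJ,
        LinearMap.neg_apply, map_neg, neg_neg]
    rw [h]
    exact hpos _ fun h0 => hv (((Module.End.isUnit_iff J).1 hJu).1 (h0.trans (map_zero J).symm))
  obtain ⟨f, L, hexp, hLs, hLcomm, -, hLA⟩ := exists_log hs hpos hPs hPpos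
  obtain ⟨a, ha, hLa⟩ := exists_sub_mem_centralizer A (hLA A hPA)
  have hσL : σ L = L := eq_of_adjoint hB (hσ L) hLs
  have hσexp : ∀ t : ℝ, σ (endExp f (t • L)) = endExp f (t • L) := fun t => by
    rw [σ.apply_endExp, map_smul, hσL]
  -- The positive square root of `-(J * J)`; the corrected inner product is `B (R u) v`, for which
  -- `ω` is represented by `R⁻¹J`.
  set R := endExpUnit f ((1 / 2 : ℝ) • L)
  have hRval : R.val = endExp f ((1 / 2 : ℝ) • L) := rfl
  have hRR : R.val * R.val = -(J * J) := by
    rw [← hexp, hRval, ← endExp_add f (Commute.refl _), ← add_smul]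
    norm_num
  have hRJ : Commute R.val J :=
    commute_endExp ((show Commute L J from hLcomm J (by noncomm_ring)).smul_left _)
  have hRpos : ∀ v, v ≠ 0 → 0 < B.compLeft R.val v v := fun v hv => by
    -- A self-adjoint square root of `R` gives `B (R v) v = B (S v) (S v)`.
    set S := endExpUnit f ((1 / 4 : ℝ) • L)
    have hSval : S.val = endExp f ((1 / 4 : ℝ) • L) := rfl
    have hSS : S.val * S.val = R.val := by
      rw [hRval, hSval, ← endExp_add f (Commute.refl _), ← add_smul]
      norm_num
    have hSv : S.val v ≠ 0 := fun h0 =>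
      hv (((Module.End.isUnit_iff _).1 S.isUnit).1 (h0.trans (map_zero S.val).symm))
    have h := hpos _ hSv
    rw [compLeft_apply, ← hSS, Module.End.mul_apply, hσ, hSval, hσexp]
    exact h
  have hRs : (B.compLeft R.val).IsSymm := ⟨fun u v => by
    rw [compLeft_apply, compLeft_apply, hσ, hRval, hσexp]
    exact hs.eq _ _⟩
  have hRB := nondegenerate_of_pos hRpos
  obtain ⟨θ, hθ⟩ := exists_involution hRB hRs
  have hRR' : ∀ w, R.val (R⁻¹.val w) = w := fun w => by
    rw [← Module.End.mul_apply, Units.mul_inv, Module.End.one_apply]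
  have hθσ : ∀ x, θ x = R⁻¹.val * σ x * R.val := fun x =>
    eq_of_adjoint hRB (hθ x) fun u v => by
      have hmul : R.val * (R⁻¹.val * σ x * R.val) = σ x * R.val := by
        rw [mul_assoc, Units.mul_inv_cancel_left]
      have hσR : σ R.val = R.val := hσexp _
      rw [compLeft_apply, compLeft_apply, ← Module.End.mul_apply, hσ, σ.map_mul_rev, hσ R.val, hσR,
        ← Module.End.mul_apply R.val, hmul]
  have hθA : ∀ x ∈ A, θ x ∈ A := fun x hx => by
    have h := endExp_conj_mem (f := f) ha hLa (-(1 / 2)) (hσA x hx)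
    rw [neg_smul, neg_neg] at h
    rwa [hθσ]
  have hJR : ∀ u v, B.compLeft R.val ((R⁻¹.val * J) u) v = ω u v := fun u v => by
    rw [compLeft_apply, Module.End.mul_apply, hRR', hJ]
  have hJJ : R⁻¹.val * J * (R⁻¹.val * J) = -1 := by
    have h1 : J * R⁻¹.val = R⁻¹.val * J := (hRJ.symm.units_inv_right).eq
    calc _ = R⁻¹.val * (J * R⁻¹.val) * J := by noncomm_ring
      _ = -(R⁻¹.val * R⁻¹.val * -(J * J)) := by rw [h1]; noncomm_ring
      _ = -(R⁻¹.val * (R⁻¹.val * R.val) * R.val) := by rw [← hRR]; noncomm_ring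
      _ = -1 := by rw [Units.inv_mul, mul_one, Units.inv_mul]
  refine ⟨θ, ⟨B.compLeft R.val, hRs, hRpos, hθ⟩, comm_of_sq_eq_neg_one hRs hRB hθ hJR hJJ,
    θ.stabilizes_iff.2 hθA, θ.stabilizes_iff.2 ?_⟩
  rw [← hpair.centralizer_left]
  exact fun x hx => θ.map_mem_centralizer hθA hx

end Existence

/-! ### Conjugacy under `G × G'`. -/

section Conjugacy

variable {ω : LinearMap.BilinForm ℝ W} {halt : ω.IsAlt} {hnd : ω.Nondegenerate}
  {A A' : Subalgebra ℝ (Module.End ℝ W)} {σ σ' : AlgInvolution ℝ (Module.End ℝ W)}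

theorem mem_symplecticSubgroup_iff (halt : ω.IsAlt) (hnd : ω.Nondegenerate)
    {g : (Module.End ℝ W)ˣ} :
    g ∈ symplecticSubgroup ω ↔ symplecticAdjoint ω halt hnd g.val = g⁻¹.val := by
  have hspec : ∀ u v, ω (g.val u) (g.val v) =
      ω u ((symplecticAdjoint ω halt hnd g.val * g.val) v) :=
    fun u v => symplecticAdjoint_spec ω halt hnd g.val u (g.val v)
  constructor
  · intro hg
    refine (Units.inv_eq_of_mul_eq_one_left ?_).symm
    refine LinearMap.ext fun v => eq_of_forall_left hnd fun u => ?_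
    rw [← hspec, hg, Module.End.one_apply]
  · intro h u v
    rw [hspec, h, Units.inv_mul, Module.End.one_apply]

theorem symplecticAdjoint_conj {h : (Module.End ℝ W)ˣ} (hh : h ∈ symplecticSubgroup ω)
    (x : Module.End ℝ W) :
    symplecticAdjoint ω halt hnd (h.val * x * h⁻¹.val) =
      h.val * symplecticAdjoint ω halt hnd x * h⁻¹.val := by
  have h1 := (mem_symplecticSubgroup_iff halt hnd).1 hh
  have h2 := (mem_symplecticSubgroup_iff halt hnd).1 (inv_mem hh)
  rw [inv_inv] at h2
  rw [AlgInvolution.map_mul_rev, AlgInvolution.map_mul_rev, h1, h2, mul_assoc]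

theorem conj_mul_mem (hpair : IsDualPairOfAlgebras ω halt hnd A A') {g g' : (Module.End ℝ W)ˣ}
    (hg : g ∈ symplecticPart ω A) (hg' : g' ∈ symplecticPart ω A') {x : Module.End ℝ W}
    (hx : x ∈ A) :
    (g * g').val * x * (g * g')⁻¹.val ∈ A ∧ (g * g')⁻¹.val * x * (g * g').val ∈ A := by
  have hA' : ∀ y ∈ A', ∀ z ∈ A, z * y = y * z := fun y hy z hz => by
    rw [← hpair.centralizer_left, Subalgebra.mem_centralizer_iff] at hy
    exact hy z hz
  have hgi := (inv_mem hg).1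
  have h1 := A.mul_mem (A.mul_mem hg.1 hx) hgi
  have h2 := A.mul_mem (A.mul_mem hgi hx) hg.1
  constructor
  · convert h1 using 1
    rw [mul_inv_rev, Units.val_mul, Units.val_mul, mul_assoc g.val, ← hA' _ hg'.1 x hx]
    simp [mul_assoc]
  · convert h2 using 1
    have h3 := hA' _ hg'.1 _ h2
    rw [mul_inv_rev, Units.val_mul, Units.val_mul]
    calc _ = g'⁻¹.val * ((g⁻¹.val * x * g.val) * g'.val) := by noncomm_ring
      _ = _ := by rw [h3, Units.inv_mul_cancel_left]

theorem IsAdaptedCartanInvolution.conj (hpair : IsDualPairOfAlgebras ω halt hnd A A')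
    (hσ : IsAdaptedCartanInvolution ω halt hnd A A' σ) {g g' : (Module.End ℝ W)ˣ}
    (hg : g ∈ symplecticPart ω A) (hg' : g' ∈ symplecticPart ω A') :
    IsAdaptedCartanInvolution ω halt hnd A A' (AlgInvolution.conj (g * g') σ) := by
  have hsA := σ.stabilizes_iff.1 hσ.stable_left
  set h := g * g'
  have hsp : h ∈ symplecticSubgroup ω := mul_mem hg.2 hg'.2
  have hcA : ∀ x ∈ A, AlgInvolution.conj h σ x ∈ A := fun x hx =>
    (conj_mul_mem hpair hg hg' (hsA _ (conj_mul_mem hpair hg hg' hx).2)).1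
  refine ⟨?_, ?_, (AlgInvolution.stabilizes_iff _).2 hcA, (AlgInvolution.stabilizes_iff _).2 ?_⟩
  · obtain ⟨B, hs, hpos, hadj⟩ := hσ.cartan
    refine ⟨B.comp h⁻¹.val h⁻¹.val, ⟨fun u v => hs.eq _ _⟩, fun v hv => hpos _ fun h0 => hv
      (((Module.End.isUnit_iff _).1 h⁻¹.isUnit).1 (h0.trans (map_zero _).symm)), fun x u v => ?_⟩
    rw [comp_apply, comp_apply, AlgInvolution.conj_apply]
    have h1 : h⁻¹.val (x u) = (h⁻¹.val * x * h.val) (h⁻¹.val u) := by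
      rw [← Module.End.mul_apply, ← Module.End.mul_apply, Units.mul_inv_cancel_right]
    rw [h1, hadj, ← Module.End.mul_apply, ← Module.End.mul_apply]
    congr 2
    rw [← mul_assoc, Units.inv_mul_cancel_left]
  · funext x
    have h1 := symplecticAdjoint_conj (halt := halt) (hnd := hnd) (inv_mem hsp) x
    rw [inv_inv] at h1
    have h2 := congrFun hσ.comm (h⁻¹.val * x * h.val)
    simp only [Function.comp_apply] at h2 ⊢
    rw [AlgInvolution.conj_apply, AlgInvolution.conj_apply, symplecticAdjoint_conj hsp, ← h2, h1]
  · rw [← hpair.centralizer_left]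
    exact fun x hx => AlgInvolution.map_mem_centralizer _ hcA hx

theorem exists_conj_eq (hpair : IsDualPairOfAlgebras ω halt hnd A A')
    (hσ : IsAdaptedCartanInvolution ω halt hnd A A' σ)
    (hσ' : IsAdaptedCartanInvolution ω halt hnd A A' σ') :
    ∃ g ∈ symplecticPart ω A, ∃ g' ∈ symplecticPart ω A', σ' = AlgInvolution.conj (g * g') σ := by
  have := hpair.semisimple_left
  obtain ⟨B, J, hs, hpos, hadj, hJ, hJJ⟩ := exists_normalized_form hσ.cartan hσ.comm
  obtain ⟨B', J', hs', hpos', hadj', hJ', hJJ'⟩ := exists_normalized_form hσ'.cartan hσ'.comm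
  have hB := nondegenerate_of_pos hpos
  have hB' := nondegenerate_of_pos hpos'
  have hσJ := involution_apply_eq_neg hs hB halt hadj hJ
  set τ := symplecticAdjoint ω halt hnd
  obtain ⟨P, hP⟩ := exists_operator B' hB
  have hPs : ∀ u v, B (P u) v = B u (P v) := fun u v => by
    rw [hP, ← hs'.eq, ← hs.eq (P v) u, hP]
  have hσP : σ P = P := eq_of_adjoint hB (hadj P) hPs
  have hPpos : ∀ v, v ≠ 0 → 0 < B (P v) v := fun v hv => by
    rw [hP]
    exact hpos' v hv
  have hPσ : ∀ x, P * σ' x = σ x * P := fun x => by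
    refine LinearMap.ext fun v => eq_of_forall_left hB fun u => ?_
    have h := hadj' x u v
    rw [← hP, ← hP, hadj P, hσP, hadj P, hσP, hadj x] at h
    exact h.symm
  have hsA := σ.stabilizes_iff.1 hσ.stable_left
  have hsA' := σ'.stabilizes_iff.1 hσ'.stable_left
  have hPA : ∀ x ∈ A, ∃ y ∈ A, P * x = y * P := fun x hx =>
    ⟨σ (σ' x), hsA _ (hsA' x hx), by rw [← hPσ, σ'.apply_apply]⟩
  have hPJ' : P * J' = J := LinearMap.ext fun u => eq_of_forall_right hB fun v => by
    rw [Module.End.mul_apply, hP, hJ', hJ]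
  -- Here `J' = P⁻¹J`, and `J` and `J'` both square to `-1`.
  have hPJP : P * J * P = J := by
    have h1 : J * J' = -P := by rw [← hPJ', mul_assoc, hJJ', mul_neg, mul_one]
    have h2 : J * P = J' := by
      rw [← neg_neg P, ← h1, mul_neg, ← mul_assoc, hJJ, neg_one_mul, neg_neg]
    rw [mul_assoc, h2, hPJ']
  obtain ⟨f, L, hexp, hLs, -, hLanti, hLA⟩ := exists_log hs hpos hPs hPpos
  obtain ⟨a, ha, hLa⟩ := exists_sub_mem_centralizer A (hLA A hPA)
  rw [hpair.centralizer_left] at hLa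
  have hσL : σ L = L := eq_of_adjoint hB (hadj L) hLs
  -- `P * J * P = J` makes `L` anticommute with `J`; since `σ L = L`, this places `L` in the Lie
  -- algebra of `Sp(W)`.
  have hτL : τ L = -L := by
    have h1 := mul_symplecticAdjoint_eq (halt := halt) (hnd := hnd) hs hB hadj hJ L
    rw [hσL, hLanti J hPJP, ← mul_neg] at h1
    exact (isUnit_of_form hnd hJ).mul_left_cancel h1
  have hτA := τ.stabilizes_iff.1 hpair.stable_left
  have hτA' := τ.stabilizes_iff.1 hpair.stable_right
  -- The factor `-1/2` is chosen so that `h = P^(-1/2)`: conjugating `σ` by the self-adjoint `h`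
  -- gives `x ↦ h² σ(x) h⁻² = P⁻¹ σ(x) P = σ' x`. In the witnesses it becomes `-1/4` because `L - τ
  -- L = 2L`.
  have hsplit : ∃ c ∈ A, ∃ c' ∈ A', c + c' = (-(1 / 2) : ℝ) • L ∧ τ c = -c ∧ τ c' = -c' := by
    refine ⟨(-(1 / 4) : ℝ) • (a - τ a), A.smul_mem (A.sub_mem ha (hτA a ha)) _,
      (-(1 / 4) : ℝ) • (L - a - τ (L - a)), A'.smul_mem (A'.sub_mem hLa (hτA' _ hLa)) _, ?_, ?_, ?_⟩
    · rw [← smul_add, map_sub τ, hτL]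
      module
    · rw [map_smul, map_sub τ, τ.apply_apply]
      module
    · rw [map_smul, map_sub τ, τ.apply_apply]
      module
  obtain ⟨c, hc, c', hc', hcc, hτc, hτc'⟩ := hsplit
  have hsp : ∀ x, τ x = -x → endExpUnit f x ∈ symplecticSubgroup ω := fun x hx => by
    rw [mem_symplecticSubgroup_iff halt hnd]
    change τ (endExp f x) = endExp f (-x)
    rw [τ.apply_endExp, hx]
  have hcomm : Commute c c' := by
    rw [← hpair.centralizer_left, Subalgebra.mem_centralizer_iff] at hc'
    exact hc' c hc
  refine ⟨endExpUnit f c, ⟨endExp_mem f hc, hsp c hτc⟩, endExpUnit f c',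
    ⟨endExp_mem f hc', hsp c' hτc'⟩, ?_⟩
  have hprod : endExpUnit f c * endExpUnit f c' = endExpUnit f ((-(1 / 2) : ℝ) • L) := by
    refine Units.ext ?_
    rw [← hcc]
    exact (endExp_add f hcomm).symm
  rw [hprod]
  set h := endExpUnit f ((-(1 / 2) : ℝ) • L)
  have hσh : σ h.val = h.val := by
    change σ (endExp f _) = endExp f _
    rw [σ.apply_endExp, map_smul, hσL]
  have hσhi : σ h⁻¹.val = h⁻¹.val := by
    change σ (endExp f _) = endExp f _
    rw [σ.apply_endExp, map_neg, map_smul, hσL]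
  have hhP : h⁻¹.val * h⁻¹.val = P := by
    rw [← hexp]
    change endExp f _ * endExp f _ = _
    rw [← endExp_add f (Commute.refl _)]
    congr 1
    module
  refine DFunLike.ext _ _ fun x => ?_
  rw [AlgInvolution.conj_apply, σ.map_mul_rev, σ.map_mul_rev, hσh, hσhi]
  have h1 := hPσ x
  rw [← hhP] at h1
  calc σ' x = h.val * (h.val * (h⁻¹.val * h⁻¹.val * σ' x)) := by
        simp [mul_assoc]
    _ = _ := by rw [h1]; simp only [mul_assoc]

end Conjugacy

end CartanInvolutions

theorem mainTheorem2 {W : Type*} [AddCommGroup W] [Module ℝ W] [FiniteDimensional ℝ W]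
    (ω : LinearMap.BilinForm ℝ W) (halt : ω.IsAlt) (hnd : ω.Nondegenerate)
    (A A' : Subalgebra ℝ (Module.End ℝ W)) (hpair : IsDualPairOfAlgebras ω halt hnd A A') :
    (∃ σ : AlgInvolution ℝ (Module.End ℝ W), IsAdaptedCartanInvolution ω halt hnd A A' σ) ∧
    ∀ σ : AlgInvolution ℝ (Module.End ℝ W), IsAdaptedCartanInvolution ω halt hnd A A' σ →
      ∀ σ' : AlgInvolution ℝ (Module.End ℝ W),
        IsAdaptedCartanInvolution ω halt hnd A A' σ' ↔
          ∃ g ∈ symplecticPart ω A, ∃ g' ∈ symplecticPart ω A',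
            σ' = AlgInvolution.conj (g * g') σ := by
  refine ⟨exists_adaptedCartanInvolution hpair, fun σ hσ σ' => ⟨exists_conj_eq hpair hσ, ?_⟩⟩
  rintro ⟨g, hg, g', hg', rfl⟩
  exact hσ.conj hpair hg hg'
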